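/- Throughout, Hilbert spaces are complex, $[\mathcal S]^{-w^*}$ is the weak* closure of the linear span of a set $\mathcal S$ of operators, $\mathcal S^*=\{T^*:T\in\mathcal S\}$, $\mathcal S'$ is the commutant of $\mathcal S$, and products of sets of operators are the sets of all products. For a linear space $\mathcal X\subset B(E,F)$ ($E,F$ Hilbert spaces), $\mathrm{Map}(\mathcal X)$ sends a projection $P\in B(E)$ to the projection onto $\overline{\mathrm{span}}\{TPy:T\in\mathcal X,\ y\in E\}$. The space $\mathcal X$ is essential if $\mathrm{Map}(\mathcal X)(I)=I$ and $\mathrm{Map}(\mathcal X^*)(I)=I$. It is reflexive if $\mathcal X=\{T\in B(E,F):Tx\in\overline{\mathrm{span}}(\mathcal Xx)\ \text{for all } x\in E\}$. It is a TRO if $\mathcal X\mathcal X^*\mathcal X\subset\mathcal X$. With $\phi=\mathrm{Map}(\mathcal X)$ and $\phi^*=\mathrm{Map}(\mathcal X^*)$, put $\mathcal S_{1,\phi}=\{I-\phi^*(P):P\in B(F)\text{ a projection}\}\subset B(E)$ and $\mathcal S_{2,\phi}=\{\phi(P):P\in B(E)\text{ a projection}\}\subset B(F)$. **Theorem 2.3.**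 Let $H_1,H_2,K_1,K_2$ be Hilbert spaces and let $\mathcal U\subset B(K_1,K_2)$, $\mathcal V\subset B(H_1,H_2)$ be essential reflexive linear spaces that are weak TRO equivalent through TROs $\mathcal M_i\subset B(H_i,K_i)$, $i=1,2$, that is, $$\mathcal U=[\mathcal M_2\mathcal V\mathcal M_1^*]^{-w^*},\qquad \mathcal V=[\mathcal M_2^*\mathcal U\mathcal M_1]^{-w^*}.$$ Let $\phi=\mathrm{Map}(\mathcal U)$, $\psi=\mathrm{Map}(\mathcal V)$, $\chi_i^*=\mathrm{Map}(\mathcal M_i^*)$, $\mathcal B_i=\mathcal S_{i,\phi}'\subset B(K_i)$ and $\mathcal A_i=\mathcal S_{i,\psi}'\subset B(H_i)$ for $i=1,2$. Then there are *-isomorphisms $\zeta_i$ from $\mathcal B_i'$ onto $\mathcal A_i'$, $i=1,2$, with $\zeta_i(P)=\chi_i^*(P)$ for every projection $P\in\mathcal B_i'$, such that the spaces $$\mathcal N_i=\{T\in B(H_i,K_i):T\zeta_i(P)=PT\ \text{ for all projections } P\in\mathcal B_i'\},\qquad i=1,2,$$ are TROs and $$\mathcal U=[\mathcal N_2\mathcal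 V\mathcal N_1^*]^{-w^*},\qquad \mathcal V=[\mathcal N_2^*\mathcal U\mathcal N_1]^{-w^*}.$$ -/

import Mathlib

noncomputable section

namespace WeakTRO

variable {E F G L : Type*}
  [NormedAddCommGroup E] [InnerProductSpace ℂ E] [CompleteSpace E]
  [NormedAddCommGroup F] [InnerProductSpace ℂ F] [CompleteSpace F]
  [NormedAddCommGroup G] [InnerProductSpace ℂ G] [CompleteSpace G]
  [NormedAddCommGroup L] [InnerProductSpace ℂ L] [CompleteSpace L]

/-- Square summable sequences of vectors of a Hilbert space. -/
def SqSummable (E : Type*) [NormedAddCommGroup E] : Type _ :=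
  {x : ℕ → E // Summable fun n => ‖x n‖ ^ 2}

/-- The pairing of `T ∈ B(E, F)` with the trace class operator `∑ₙ xₙ ⊗ yₙ*`, that is
`∑ₙ ⟪yₙ, T xₙ⟫`. The series converges absolutely, and every trace class operator has this form. -/
def pairing (T : E →L[ℂ] F) (p : SqSummable E × SqSummable F) : ℂ :=
  ∑' n, inner ℂ (p.2.1 n) (T (p.1.1 n))

/-- The series defining the pairing is summable (so the `∑'` is never a default value). -/
theorem summable_pairing (T : E →L[ℂ] F) (p : SqSummable E × SqSummable F) :
    Summable fun n => inner ℂ (p.2.1 n) (T (p.1.1 n)) := by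
  refine Summable.of_norm_bounded
    (g := fun n => ‖T‖ * (‖p.1.1 n‖ ^ 2 + ‖p.2.1 n‖ ^ 2))
    ((p.1.2.add p.2.2).mul_left _) fun n => ?_
  have h1 := norm_inner_le_norm (𝕜 := ℂ) (p.2.1 n) (T (p.1.1 n))
  have h2 := T.le_opNorm (p.1.1 n)
  have h3 : ‖p.2.1 n‖ * ‖T (p.1.1 n)‖ ≤ ‖p.2.1 n‖ * (‖T‖ * ‖p.1.1 n‖) := by gcongr
  nlinarith [norm_nonneg T, mul_nonneg (norm_nonneg T) (sq_nonneg (‖p.1.1 n‖ - ‖p.2.1 n‖)),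
    mul_nonneg (norm_nonneg T) (sq_nonneg (‖p.1.1 n‖)),
    mul_nonneg (norm_nonneg T) (sq_nonneg (‖p.2.1 n‖))]

variable (E F) in
/-- The weak* (ultraweak) topology of `B(E, F)`, as the dual of the trace class operators:
the coarsest topology for which all the functionals `T ↦ pairing T p` are continuous. -/
abbrev weakStarTopology : TopologicalSpace (E →L[ℂ] F) :=
  TopologicalSpace.induced (fun T p => pairing T p) Pi.topologicalSpace

/-- `[S]^{-w*}`: the weak* closure of the linear span of `S`. -/
def wspan (S : Set (E →L[ℂ] F)) : Set (E →L[ℂ] F) :=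
  @closure _ (weakStarTopology E F) (Submodule.span ℂ S : Set (E →L[ℂ] F))

/-- `S* = {T* : T ∈ S}`. -/
def adj (S : Set (E →L[ℂ] F)) : Set (F →L[ℂ] E) :=
  ContinuousLinearMap.adjoint '' S

/-- The set of products `X Y Z = {x y z : x ∈ X, y ∈ Y, z ∈ Z}`. -/
def triple (X : Set (G →L[ℂ] L)) (Y : Set (F →L[ℂ] G)) (Z : Set (E →L[ℂ] F)) :
    Set (E →L[ℂ] L) :=
  {T | ∃ x ∈ X, ∃ y ∈ Y, ∃ z ∈ Z, T = x ∘L y ∘L z}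

/-- A ternary ring of operators: a linear space `M` with `M M* M ⊆ M`. -/
def IsTRO (M : Submodule ℂ (E →L[ℂ] F)) : Prop :=
  triple (M : Set (E →L[ℂ] F)) (adj (M : Set (E →L[ℂ] F))) (M : Set (E →L[ℂ] F)) ⊆
    (M : Set (E →L[ℂ] F))

/-- The TROs `M₁ ⊆ B(H₁, K₁)`, `M₂ ⊆ B(H₂, K₂)` implement a weak TRO equivalence of
`U ⊆ B(K₁, K₂)` and `V ⊆ B(H₁, H₂)`:
`U = [M₂ V M₁*]^{-w*}` and `V = [M₂* U M₁]^{-w*}`. -/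
structure Implements {H₁ H₂ K₁ K₂ : Type*}
    [NormedAddCommGroup H₁] [InnerProductSpace ℂ H₁] [CompleteSpace H₁]
    [NormedAddCommGroup H₂] [InnerProductSpace ℂ H₂] [CompleteSpace H₂]
    [NormedAddCommGroup K₁] [InnerProductSpace ℂ K₁] [CompleteSpace K₁]
    [NormedAddCommGroup K₂] [InnerProductSpace ℂ K₂] [CompleteSpace K₂]
    (M₁ : Submodule ℂ (H₁ →L[ℂ] K₁)) (M₂ : Submodule ℂ (H₂ →L[ℂ] K₂))
    (U : Submodule ℂ (K₁ →L[ℂ] K₂)) (V : Submodule ℂ (H₁ →L[ℂ] H₂)) : Prop where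
  tro₁ : IsTRO M₁
  tro₂ : IsTRO M₂
  eq_left : (U : Set (K₁ →L[ℂ] K₂)) =
    wspan (triple (M₂ : Set (H₂ →L[ℂ] K₂)) (V : Set (H₁ →L[ℂ] H₂))
      (adj (M₁ : Set (H₁ →L[ℂ] K₁))))
  eq_right : (V : Set (H₁ →L[ℂ] H₂)) =
    wspan (triple (adj (M₂ : Set (H₂ →L[ℂ] K₂))) (U : Set (K₁ →L[ℂ] K₂))
      (M₁ : Set (H₁ →L[ℂ] K₁)))

/-- The reflexive hull `Ref U = {T : T x ∈ closure [U x] for each x}`. -/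
def refHull (U : Set (E →L[ℂ] F)) : Set (E →L[ℂ] F) :=
  {T | ∀ x, T x ∈ (Submodule.span ℂ ((fun S : E →L[ℂ] F => S x) '' U)).topologicalClosure}

/-- A space of operators is reflexive if it equals its reflexive hull. -/
def IsReflexive (U : Submodule ℂ (E →L[ℂ] F)) : Prop :=
  (U : Set (E →L[ℂ] F)) = refHull U

/-- `Map U`: it sends a projection `P` to the projection onto the closed linear span of
`{T P y : T ∈ U, y ∈ E}`. -/
def Map (U : Set (E →L[ℂ] F)) (P : E →L[ℂ] E) : F →L[ℂ] F :=
  (Submodule.span ℂ {z : F | ∃ T ∈ U, ∃ y : E, z = T (P y)}).topologicalClosure.starProjection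

/-- `U` is essential: `Map U` and `Map U*` send the identity to the identity. -/
def IsEssential (U : Submodule ℂ (E →L[ℂ] F)) : Prop :=
  Map (U : Set (E →L[ℂ] F)) 1 = 1 ∧ Map (adj (U : Set (E →L[ℂ] F))) 1 = 1

/-- `S_{1,φ} = {φ*(P)^⊥ : P a projection of F}`, where `φ = Map U` and `φ* = Map U*`. -/
def S1 (U : Submodule ℂ (E →L[ℂ] F)) : Set (E →L[ℂ] E) :=
  {Q | ∃ P : F →L[ℂ] F, IsStarProjection P ∧ Q = 1 - Map (adj (U : Set (E →L[ℂ] F))) P}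

/-- `S_{2,φ} = {φ(P) : P a projection of E}`, where `φ = Map U`. -/
def S2 (U : Submodule ℂ (E →L[ℂ] F)) : Set (F →L[ℂ] F) :=
  {Q | ∃ P : E →L[ℂ] E, IsStarProjection P ∧ Q = Map (U : Set (E →L[ℂ] F)) P}

/-- The commutant `S'` of a self-adjoint set of operators, as a *-algebra (see `coe_comm`). -/
abbrev comm (S : Set (E →L[ℂ] E)) : StarSubalgebra ℂ (E →L[ℂ] E) :=
  StarSubalgebra.centralizer ℂ S

theorem coe_comm {S : Set (E →L[ℂ] E)} (hS : ∀ T ∈ S, star T ∈ S) :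
    (comm S : Set (E →L[ℂ] E)) = {T | ∀ A ∈ S, A * T = T * A} := by
  ext T
  simp only [SetLike.mem_coe, StarSubalgebra.mem_centralizer_iff, Set.mem_ofPred_eq]
  exact ⟨fun h A hA => (h A hA).1, fun h A hA => ⟨h A hA, h _ (hS A hA)⟩⟩

theorem star_mem_S1 (U : Submodule ℂ (E →L[ℂ] F)) : ∀ T ∈ S1 U, star T ∈ S1 U := by
  rintro T ⟨P, hP, rfl⟩
  refine ⟨P, hP, ?_⟩
  have h : star (Map (adj (U : Set (E →L[ℂ] F))) P) = Map (adj (U : Set (E →L[ℂ] F))) P :=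
    isStarProjection_starProjection.isSelfAdjoint
  rw [star_sub, star_one, h]

theorem star_mem_S2 (U : Submodule ℂ (E →L[ℂ] F)) : ∀ T ∈ S2 U, star T ∈ S2 U := by
  rintro T ⟨P, hP, rfl⟩
  refine ⟨P, hP, ?_⟩
  exact isStarProjection_starProjection.isSelfAdjoint

/-- The von Neumann algebra `S_{1,φ}'`, `φ = Map U`. -/
def alg1 (U : Submodule ℂ (E →L[ℂ] F)) : StarSubalgebra ℂ (E →L[ℂ] E) := comm (S1 U)

/-- The von Neumann algebra `S_{2,φ}'`, `φ = Map U`. -/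
def alg2 (U : Submodule ℂ (E →L[ℂ] F)) : StarSubalgebra ℂ (F →L[ℂ] F) := comm (S2 U)

/-- The *-isomorphism `ζ` from an algebra `C` on `F` onto an algebra `D` on `E` extends the
restriction of `Map M*` to the projections of `C`. -/
def Extends {C : StarSubalgebra ℂ (F →L[ℂ] F)} {D : StarSubalgebra ℂ (E →L[ℂ] E)}
    (ζ : C ≃⋆ₐ[ℂ] D) (M : Submodule ℂ (E →L[ℂ] F)) : Prop :=
  ∀ P : C, IsStarProjection (P : F →L[ℂ] F) →
    (ζ P : E →L[ℂ] E) = Map (adj (M : Set (E →L[ℂ] F))) (P : F →L[ℂ] F)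

/-- `{T ∈ B(E, F) : T ζ(P) = P T for all projections P ∈ C}`. -/
def intertwiners {C : StarSubalgebra ℂ (F →L[ℂ] F)} {D : StarSubalgebra ℂ (E →L[ℂ] E)}
    (ζ : C ≃⋆ₐ[ℂ] D) : Submodule ℂ (E →L[ℂ] F) where
  carrier := {T | ∀ P : C, IsStarProjection (P : F →L[ℂ] F) →
    T ∘L (ζ P : E →L[ℂ] E) = (P : F →L[ℂ] F) ∘L T}
  add_mem' := by
    intro S T hS hT P hP
    rw [ContinuousLinearMap.add_comp, ContinuousLinearMap.comp_add, hS P hP, hT P hP]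
  zero_mem' := by
    intro P _
    rw [ContinuousLinearMap.zero_comp, ContinuousLinearMap.comp_zero]
  smul_mem' := by
    intro c T hT P hP
    rw [ContinuousLinearMap.smul_comp, ContinuousLinearMap.comp_smul, hT P hP]

end WeakTRO

end

noncomputable section

namespace WeakTRO

open ContinuousLinearMap

variable {E F G : Type*}
  [NormedAddCommGroup E] [InnerProductSpace ℂ E] [CompleteSpace E]
  [NormedAddCommGroup F] [InnerProductSpace ℂ F] [CompleteSpace F]
  [NormedAddCommGroup G] [InnerProductSpace ℂ G] [CompleteSpace G]

/-! Reflexivity reduces membership in `U` or `V` to the vanishing of matrix coefficients `⟪y, T x⟫`.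
These are weak* continuous, so weak* closed spans enter only through them. Essentiality makes `M₁`
and `M₂` nondegenerate.

The central notion is `Intertwined M X Y`: `m Y = X m` and `Y m* = m* X` for all `m ∈ M`.
Nondegeneracy makes each of `X`, `Y` determine the other, and forces `Y = Map M* X` when `X` is a
projection. A partner `Y` exists once `X` and `X*` commute with `M M*` (`exists_intertwined`), and
this passes to double commutants. Since `M₂` intertwines the range of `φ` with that of `ψ`
(`intertwined_map`; the TRO property enters here), and likewise `M₁` for the adjoint spaces, the
maps `ζᵢ` are *-isomorphisms.

As `Mᵢ ⊆ Nᵢ`, only `N₂ V N₁* ⊆ U` and its mirror image need reflexivity (`IsReflexive.comp_mem`). If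
`y ⊥ U x`, there are `P ∈ S2 U` and `Q ∈ S1 U` with `(1 - P) U Q = 0`, `P y = 0` and `Q x = x`.
Transporting them to `V` annihilates the coefficient of `R v S` at `x`, `y`. -/

theorem op_mul_apply (A B : E →L[ℂ] E) (x : E) : (A * B) x = A (B x) := rfl

/-! ### Adjoints of sets of operators and vanishing of matrix coefficients -/

theorem adjoint_mem_adj {S : Set (E →L[ℂ] F)} {T : E →L[ℂ] F} (hT : T ∈ S) :
    adjoint T ∈ adj S := ⟨T, hT, rfl⟩

@[simp]
theorem adj_adj (S : Set (E →L[ℂ] F)) : adj (adj S) = S := by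
  simp [adj, Set.image_image]

theorem forall_mem_adj {S : Set (E →L[ℂ] F)} {p : (F →L[ℂ] E) → Prop} :
    (∀ T ∈ adj S, p T) ↔ ∀ T ∈ S, p (adjoint T) := by
  simp [adj]

theorem mem_topologicalClosure_of_orthogonal {S : Set E} {x : E}
    (h : ∀ y, (∀ z ∈ S, inner ℂ y z = 0) → inner ℂ y x = 0) :
    x ∈ (Submodule.span ℂ S).topologicalClosure := by
  rw [← Submodule.orthogonal_orthogonal_eq_closure, Submodule.mem_orthogonal]
  intro y hy
  refine h y fun z hz => ?_
  exact (Submodule.mem_orthogonal' _ _).1 hy z (Submodule.subset_span hz)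

theorem inner_eq_zero_of_mem_topologicalClosure {S : Set E} {x y : E}
    (hx : x ∈ (Submodule.span ℂ S).topologicalClosure)
    (h : ∀ z ∈ S, inner ℂ y z = 0) : inner ℂ y x = 0 := by
  rw [← Submodule.orthogonal_orthogonal_eq_closure, Submodule.mem_orthogonal] at hx
  refine hx y ((Submodule.mem_orthogonal' _ _).2 fun z hz => ?_)
  induction hz using Submodule.span_induction with
  | mem z hz => exact h z hz
  | zero => simp
  | add a b _ _ ha hb => rw [inner_add_right, ha, hb, add_zero]
  | smul c a _ ha => rw [inner_smul_right, ha, mul_zero]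

/-- The sequence with the single nonzero entry `x`. -/
def SqSummable.single (x : E) : SqSummable E :=
  ⟨fun n => if n = 0 then x else 0, by
    refine summable_of_ne_finset_zero (s := {0}) fun n hn => ?_
    simp [Finset.notMem_singleton.1 hn]⟩

theorem pairing_single (T : E →L[ℂ] F) (x : E) (y : F) :
    pairing T (SqSummable.single x, SqSummable.single y) = inner ℂ y (T x) := by
  rw [pairing, tsum_eq_single 0]
  · simp [SqSummable.single]
  · intro n hn
    simp [SqSummable.single, hn]

/-- A matrix coefficient that vanishes on `S` vanishes on the weak* closed span of `S`. -/
theorem inner_eq_zero_of_mem_wspan {S : Set (E →L[ℂ] F)} {T : E →L[ℂ] F} (hT : T ∈ wspan S)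
    {x : E} {y : F} (h : ∀ s ∈ S, inner ℂ y (s x) = 0) : inner ℂ y (T x) = 0 := by
  let _ := weakStarTopology E F
  -- Pairing with two single-entry sequences is a matrix coefficient, so it is one of the
  -- functionals defining the topology.
  have hcont : Continuous fun T : E →L[ℂ] F => inner ℂ y (T x) := by
    have h1 : Continuous fun (T : E →L[ℂ] F) (p : SqSummable E × SqSummable F) => pairing T p :=
      continuous_induced_dom
    have h2 := (continuous_apply (SqSummable.single x, SqSummable.single y)).comp h1
    refine h2.congr fun T => ?_
    exact pairing_single T x y
  have hclosed : IsClosed {T : E →L[ℂ] F | inner ℂ y (T x) = 0} :=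
    isClosed_singleton.preimage hcont
  refine closure_minimal (fun s hs => ?_) hclosed hT
  change inner ℂ y (s x) = 0
  induction hs using Submodule.span_induction with
  | mem z hz => exact h z hz
  | zero => simp
  | add a b _ _ ha hb => rw [add_apply, inner_add_right, ha, hb, add_zero]
  | smul c a _ ha => rw [smul_apply, inner_smul_right, ha, mul_zero]

theorem subset_wspan (S : Set (E →L[ℂ] F)) : S ⊆ wspan S :=
  fun _ hT => @subset_closure _ (weakStarTopology E F) _ _ (Submodule.subset_span hT)

theorem wspan_mono {S S' : Set (E →L[ℂ] F)} (h : S ⊆ S') : wspan S ⊆ wspan S' :=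
  @closure_mono _ (weakStarTopology E F) _ _ (Submodule.span_mono h)

/-- A reflexive space is determined by its vanishing matrix coefficients. -/
theorem IsReflexive.mem_of_inner {U : Submodule ℂ (E →L[ℂ] F)} (hU : IsReflexive U)
    {T : E →L[ℂ] F}
    (h : ∀ x y, (∀ u ∈ U, inner ℂ y (u x) = 0) → inner ℂ y (T x) = 0) : T ∈ U := by
  rw [← SetLike.mem_coe, hU]
  intro x
  refine mem_topologicalClosure_of_orthogonal fun y hy => h x y fun u hu => ?_
  exact hy _ ⟨u, hu, rfl⟩

theorem IsReflexive.wspan_subset {U : Submodule ℂ (E →L[ℂ] F)} (hU : IsReflexive U)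
    {S : Set (E →L[ℂ] F)} (hS : S ⊆ U) : wspan S ⊆ U := fun _ hT =>
  hU.mem_of_inner fun _ _ h => inner_eq_zero_of_mem_wspan hT fun s hs => h s (hS hs)

/-! ### Nondegenerate sets of operators -/

/-- Neither `M` nor `M*` has a common kernel. -/
structure Nondegenerate (M : Set (E →L[ℂ] F)) : Prop where
  right : ∀ x, (∀ m ∈ M, m x = 0) → x = 0
  left : ∀ y, (∀ m ∈ M, adjoint m y = 0) → y = 0

theorem Nondegenerate.adj {M : Set (E →L[ℂ] F)} (hM : Nondegenerate M) :
    Nondegenerate (adj M) where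
  right y h := hM.left y fun m hm => h _ (adjoint_mem_adj hm)
  left x h := hM.right x fun m hm => by simpa using h _ (adjoint_mem_adj hm)

/-- The ranges of the elements of `U` span a dense subspace, and `y` is orthogonal to all of them,
hence to itself. -/
theorem eq_zero_of_map_one {U : Set (E →L[ℂ] F)} (h : Map U 1 = 1) {y : F}
    (hy : ∀ u ∈ U, adjoint u y = 0) : y = 0 := by
  have h1 : y ∈ (Submodule.span ℂ
      {z : F | ∃ T ∈ U, ∃ x : E, z = T ((1 : E →L[ℂ] E) x)}).topologicalClosure := by
    rw [← Submodule.starProjection_eq_self_iff]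
    exact congr($h y)
  have h2 : inner ℂ y y = 0 := inner_eq_zero_of_mem_topologicalClosure h1 <| by
    rintro _ ⟨u, hu, x, rfl⟩
    rw [← adjoint_inner_left, hy u hu, inner_zero_left]
  exact inner_self_eq_zero.1 h2

theorem IsEssential.nondegenerate {U : Submodule ℂ (E →L[ℂ] F)} (hU : IsEssential U) :
    Nondegenerate (U : Set (E →L[ℂ] F)) where
  right x h := eq_zero_of_map_one hU.2 fun u hu => by
    obtain ⟨u, hu, rfl⟩ := hu
    simpa using h u hu
  left y h := eq_zero_of_map_one hU.1 h

theorem Nondegenerate.eq_of_apply {M : Set (E →L[ℂ] F)} (hM : Nondegenerate M) {x y : E}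
    (h : ∀ m ∈ M, m x = m y) : x = y :=
  sub_eq_zero.1 <| hM.right _ fun m hm => by rw [map_sub, h m hm, sub_self]

/-- The vectors `m* k` are total; after taking adjoints this is the absence of a common kernel. -/
theorem Nondegenerate.ext {M : Set (E →L[ℂ] F)} (hM : Nondegenerate M) {A B : E →L[ℂ] G}
    (h : ∀ m ∈ M, ∀ k, A (adjoint m k) = B (adjoint m k)) : A = B := by
  suffices H : adjoint A = adjoint B by simpa using congr(adjoint $H)
  ext1 w
  refine hM.eq_of_apply fun m hm => ext_inner_right ℂ fun k => ?_
  rw [← adjoint_inner_right m, ← adjoint_inner_right m, adjoint_inner_left A,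
    adjoint_inner_left B, h m hm]

/-! ### Operators intertwined by a set of operators -/

/-- `X` and `Y` are intertwined by every element of `M ∪ M*`. -/
def Intertwined (M : Set (E →L[ℂ] F)) (X : F →L[ℂ] F) (Y : E →L[ℂ] E) : Prop :=
  ∀ m ∈ M, (∀ x, m (Y x) = X (m x)) ∧ ∀ y, Y (adjoint m y) = adjoint m (X y)

namespace Intertwined

variable {M : Set (E →L[ℂ] F)} {X X' : F →L[ℂ] F} {Y Y' : E →L[ℂ] E}

theorem symm (h : Intertwined M X Y) : Intertwined (adj M) Y X := by
  rintro _ ⟨m, hm, rfl⟩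
  refine ⟨fun x => ((h m hm).2 x).symm, fun y => ?_⟩
  rw [adjoint_adjoint, (h m hm).1]

theorem star (h : Intertwined M X Y) : Intertwined M (star X) (star Y) := by
  intro m hm
  refine ⟨fun x => ext_inner_left ℂ fun k => ?_, fun y => ext_inner_left ℂ fun k => ?_⟩
  · rw [← adjoint_inner_left, star_eq_adjoint, star_eq_adjoint, adjoint_inner_right,
      (h m hm).2, adjoint_inner_left, adjoint_inner_right]
  · rw [star_eq_adjoint, star_eq_adjoint, adjoint_inner_right, adjoint_inner_right,
      adjoint_inner_right, adjoint_inner_right, (h m hm).1]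

theorem one : Intertwined M 1 1 := fun _ _ => ⟨fun _ => rfl, fun _ => rfl⟩

theorem add (h : Intertwined M X Y) (h' : Intertwined M X' Y') :
    Intertwined M (X + X') (Y + Y') := fun m hm =>
  ⟨fun x => by simp [(h m hm).1, (h' m hm).1], fun y => by simp [(h m hm).2, (h' m hm).2]⟩

theorem sub (h : Intertwined M X Y) (h' : Intertwined M X' Y') :
    Intertwined M (X - X') (Y - Y') := fun m hm =>
  ⟨fun x => by simp [(h m hm).1, (h' m hm).1], fun y => by simp [(h m hm).2, (h' m hm).2]⟩

theorem mul (h : Intertwined M X Y) (h' : Intertwined M X' Y') :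
    Intertwined M (X * X') (Y * Y') := fun m hm =>
  ⟨fun x => by simp [(h m hm).1, (h' m hm).1], fun y => by simp [(h m hm).2, (h' m hm).2]⟩

theorem smul (c : ℂ) (h : Intertwined M X Y) : Intertwined M (c • X) (c • Y) := fun m hm =>
  ⟨fun x => by simp [(h m hm).1], fun y => by simp [(h m hm).2]⟩

/-- The relation prescribes `Y` on the total set of vectors `m* k`. This uniqueness later yields
every algebraic identity for `ζ`. -/
theorem right_unique (hM : Nondegenerate M) (h : Intertwined M X Y) (h' : Intertwined M X Y') :
    Y = Y' :=
  hM.ext fun m hm k => by rw [(h m hm).2, (h' m hm).2]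

theorem left_unique (hM : Nondegenerate M) (h : Intertwined M X Y) (h' : Intertwined M X' Y) :
    X = X' :=
  right_unique hM.adj h.symm h'.symm

/-- Projections are intertwined if `M` and `M*` exchange their ranges. -/
theorem of_submodules {W : Submodule ℂ F} {Z : Submodule ℂ E} [W.HasOrthogonalProjection]
    [Z.HasOrthogonalProjection] (h₁ : ∀ m ∈ M, ∀ z ∈ Z, m z ∈ W)
    (h₂ : ∀ m ∈ M, ∀ w ∈ W, adjoint m w ∈ Z) :
    Intertwined M W.starProjection Z.starProjection := by
  intro m hm
  constructor
  · intro x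
    refine (Submodule.eq_starProjection_of_mem_of_inner_eq_zero
      (h₁ m hm _ (Submodule.starProjection_apply_mem _ _)) fun w hw => ?_).symm
    rw [← map_sub, ← adjoint_inner_right]
    exact Submodule.starProjection_inner_eq_zero _ _ (h₂ m hm w hw)
  · intro y
    refine Submodule.eq_starProjection_of_mem_of_inner_eq_zero
      (h₂ m hm _ (Submodule.starProjection_apply_mem _ _)) fun z hz => ?_
    rw [← map_sub, adjoint_inner_left]
    exact Submodule.starProjection_inner_eq_zero _ _ (h₁ m hm z hz)

/-- The operator intertwined with a projection `P` is `Map M* P`. -/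
theorem eq_map (hM : Nondegenerate M) (hX : IsStarProjection X) (h : Intertwined M X Y) :
    Y = Map (adj M) X := by
  refine hM.ext fun m hm k => ?_
  rw [(h m hm).2]
  refine (Submodule.eq_starProjection_of_mem_of_inner_eq_zero ?_ fun w hw => ?_).symm
  · exact Submodule.le_topologicalClosure _
      (Submodule.subset_span ⟨_, adjoint_mem_adj hm, k, rfl⟩)
  · refine inner_eq_zero_of_mem_topologicalClosure hw ?_
    rintro _ ⟨_, ⟨n, hn, rfl⟩, y, rfl⟩
    -- The two relations make `X` commute with `m n*`, so `m* (k - X k)` is orthogonal to `n* X y`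
    -- because `X (1 - X) = 0`.
    have h1 : m (adjoint n (X y)) = X (m (adjoint n y)) := by
      rw [← (h n hn).2, (h m hm).1]
    have h2 : X * X = X := hX.isIdempotentElem
    have h3 : adjoint X = X := hX.isSelfAdjoint
    rw [← map_sub, adjoint_inner_left, h1, ← adjoint_inner_left, h3, map_sub,
      ← op_mul_apply, h2, sub_self, inner_zero_left]

end Intertwined

/-! ### Transporting the commutant of `M M*` to the commutant of `M* M` -/

/-- `f ↦ ∑ₘ m* X f(m)`. -/
def adjointSum (M : Set (E →L[ℂ] F)) (X : F →L[ℂ] F) : (M →₀ F) →ₗ[ℂ] E :=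
  Finsupp.lsum ℂ fun m => (adjoint m.1 ∘L X).toLinearMap

theorem adjointSum_apply (M : Set (E →L[ℂ] F)) (X : F →L[ℂ] F) (f : M →₀ F) :
    adjointSum M X f = f.sum fun m y => adjoint m.1 (X y) := rfl

/-- In each Gram term `⟪X y, n m* X y'⟫` the right-hand `X` moves past `n m*` and joins the other as
`X* X`. -/
theorem inner_adjointSum {M : Set (E →L[ℂ] F)} {X : F →L[ℂ] F}
    (hX : ∀ m ∈ M, ∀ n ∈ M, ∀ y, X (m (adjoint n y)) = m (adjoint n (X y))) (f : M →₀ F) :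
    inner ℂ (adjointSum M X f) (adjointSum M X f) =
      inner ℂ (adjointSum M (star X * X) f) (adjointSum M 1 f) := by
  simp only [adjointSum_apply, Finsupp.sum, sum_inner, inner_sum]
  refine Finset.sum_congr rfl fun n _ => Finset.sum_congr rfl fun m _ => ?_
  rw [adjoint_inner_left, adjoint_inner_left, ← hX _ m.2 _ n.2, op_mul_apply, star_eq_adjoint,
    adjoint_inner_left]
  rfl

/-- With `Z` the square root of `‖X‖² - X* X`, the difference of the squares of the two sides is `‖∑
m* Z f(m)‖² ≥ 0`. -/
theorem norm_adjointSum_le {M : Set (E →L[ℂ] F)} {X : F →L[ℂ] F}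
    (hX : ∀ m ∈ M, ∀ n ∈ M, ∀ y, X (m (adjoint n y)) = m (adjoint n (X y)))
    (hX' : ∀ m ∈ M, ∀ n ∈ M, ∀ y, star X (m (adjoint n y)) = m (adjoint n (star X y)))
    (f : M →₀ F) : ‖adjointSum M X f‖ ≤ ‖X‖ * ‖adjointSum M 1 f‖ := by
  set D : F →L[ℂ] F := algebraMap ℝ _ (‖X‖ ^ 2) - star X * X with hD
  have hDpos : 0 ≤ D := sub_nonneg.2 CStarAlgebra.star_mul_le_algebraMap_norm_sq
  set Z := CFC.sqrt D with hZ
  have hZsa : star Z = Z := (CFC.sqrt_nonneg D).isSelfAdjoint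
  have hZZ : Z * Z = D := CFC.sqrt_mul_sqrt_self D
  have hZc : ∀ m ∈ M, ∀ n ∈ M, ∀ y, Z (m (adjoint n y)) = m (adjoint n (Z y)) := by
    intro m hm n hn y
    have hc : Commute D (m ∘L adjoint n) := by
      ext y
      simp [hD, Algebra.algebraMap_eq_smul_one, hX m hm n hn, hX' m hm n hn]
    -- The functional calculus preserves commutation, so `Z` satisfies the same hypothesis as `X`.
    have : Commute Z (m ∘L adjoint n) := hc.cfcₙ_nnreal _
    exact congr($this y)
  have h1 := inner_adjointSum hX f
  have h2 := inner_adjointSum hZc f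
  rw [hZsa, hZZ] at h2
  have h3 : adjointSum M D f = ((‖X‖ ^ 2 : ℝ) : ℂ) • adjointSum M 1 f -
      adjointSum M (star X * X) f := by
    simp [adjointSum_apply, hD, Algebra.algebraMap_eq_smul_one, Finsupp.sum, Finset.smul_sum,
      Finset.sum_sub_distrib, ← Complex.coe_smul]
  rw [h3, inner_sub_left, ← h1, inner_smul_left, Complex.conj_ofReal,
    inner_self_eq_norm_sq_to_K, inner_self_eq_norm_sq_to_K, inner_self_eq_norm_sq_to_K] at h2
  have h4 : ‖adjointSum M Z f‖ ^ 2 =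
      ‖X‖ ^ 2 * ‖adjointSum M 1 f‖ ^ 2 - ‖adjointSum M X f‖ ^ 2 := by
    apply Complex.ofReal_injective
    push_cast at h2 ⊢
    exact h2
  refine le_of_sq_le_sq ?_ (by positivity)
  rw [mul_pow]
  nlinarith [sq_nonneg ‖adjointSum M Z f‖]

/-- The norm estimate makes `∑ m* y ↦ ∑ m* X y` well defined and bounded on a dense subspace; `Y` is
its extension. -/
theorem exists_intertwined {M : Set (E →L[ℂ] F)} (hM : Nondegenerate M) {X : F →L[ℂ] F}
    (hX : ∀ m ∈ M, ∀ n ∈ M, ∀ y, X (m (adjoint n y)) = m (adjoint n (X y)))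
    (hX' : ∀ m ∈ M, ∀ n ∈ M, ∀ y, star X (m (adjoint n y)) = m (adjoint n (star X y))) :
    ∃ Y : E →L[ℂ] E, Intertwined M X Y := by
  have hdense : DenseRange (adjointSum M 1) := by
    have h : (LinearMap.range (adjointSum M 1)).topologicalClosure = ⊤ := by
      rw [← Submodule.orthogonal_orthogonal_eq_closure, Submodule.orthogonal_eq_top_iff,
        Submodule.eq_bot_iff]
      refine fun x hx => hM.right x fun m hm => ext_inner_left ℂ fun y => ?_
      rw [inner_zero_right, ← adjoint_inner_left]
      refine (Submodule.mem_orthogonal _ _).1 hx _ ⟨Finsupp.single ⟨m, hm⟩ y, ?_⟩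
      simp [adjointSum_apply]
    exact Submodule.dense_iff_topologicalClosure_eq_top.2 h
  set Y : E →L[ℂ] E := (adjointSum M X).extendOfNorm (adjointSum M 1)
  have hY : ∀ m ∈ M, ∀ y, Y (adjoint m y) = adjoint m (X y) := by
    intro m hm y
    have h := LinearMap.extendOfNorm_eq hdense ⟨_, norm_adjointSum_le hX hX'⟩
      (Finsupp.single ⟨m, hm⟩ y)
    simpa [adjointSum_apply] using h
  refine ⟨Y, fun m hm => ⟨fun x => ?_, hY m hm⟩⟩
  have h : m ∘L Y = X ∘L m := hM.ext fun n hn k => by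
    simp [hY n hn, hX m hm n hn]
  exact congr($h x)

/-- If `M` intertwines the elements of `S` with those of `S'`, then it intertwines the elements
of the double commutant of `S` with those of the double commutant of `S'`. -/
theorem exists_intertwined_comm_comm {M : Set (E →L[ℂ] F)} (hM : Nondegenerate M)
    {S : Set (F →L[ℂ] F)} {S' : Set (E →L[ℂ] E)} (hS : ∀ s ∈ S, ∃ t ∈ S', Intertwined M s t)
    {X : F →L[ℂ] F} (hX : X ∈ comm (comm S : Set (F →L[ℂ] F))) :
    ∃ Y ∈ comm (comm S' : Set (E →L[ℂ] E)), Intertwined M X Y := by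
  -- Compressions `m W n*` of the commutant of `S'` commute with `S`, hence with `X`. The case `W =
  -- 1` produces `Y`; general `W` shows that `Y` commutes with `W`.
  have hcomm : ∀ W ∈ comm S', ∀ m ∈ M, ∀ n ∈ M, m ∘L W ∘L adjoint n ∈ comm S := by
    intro W hW m hm n hn
    rw [StarSubalgebra.mem_centralizer_iff] at hW ⊢
    have key : ∀ s t, Intertwined M s t → t * W = W * t →
        s * (m ∘L W ∘L adjoint n) = (m ∘L W ∘L adjoint n) * s := by
      intro s t hst htW
      ext y
      have h : t (W (adjoint n y)) = W (t (adjoint n y)) := congr($htW (adjoint n y))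
      simp only [op_mul_apply, comp_apply]
      rw [← (hst n hn).2, ← h, (hst m hm).1]
    intro s hs
    obtain ⟨t, ht, hst⟩ := hS s hs
    exact ⟨key s t hst (hW t ht).1, key _ _ hst.star (hW t ht).2⟩
  have hXc : ∀ X ∈ comm (comm S : Set (F →L[ℂ] F)), ∀ Z ∈ comm S, ∀ y, X (Z y) = Z (X y) := by
    intro X hX Z hZ y
    have h := ((StarSubalgebra.mem_centralizer_iff ℂ).1 hX Z hZ).1
    exact congr($h y).symm
  have hone : ∀ m ∈ M, ∀ n ∈ M, m ∘L (1 : E →L[ℂ] E) ∘L adjoint n ∈ comm S :=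
    hcomm 1 (one_mem _)
  obtain ⟨Y, hY⟩ := exists_intertwined hM (X := X)
    (fun m hm n hn y => hXc X hX _ (hone m hm n hn) y)
    fun m hm n hn y => hXc _ (star_mem hX) _ (hone m hm n hn) y
  have hWY : ∀ W ∈ comm S', W * Y = Y * W := fun W hW =>
    hM.ext fun n hn k => hM.eq_of_apply fun m hm => by
      have h := hXc X hX _ (hcomm W hW m hm n hn) k
      simp only [comp_apply] at h
      rw [op_mul_apply, op_mul_apply, (hY n hn).2, (hY m hm).1, h]
  exact ⟨Y, (StarSubalgebra.mem_centralizer_iff ℂ).2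
    fun W hW => ⟨hWY W hW, hWY _ (star_mem hW)⟩, hY⟩

/-- An intertwining relation that is total in both directions is a *-isomorphism. -/
theorem exists_starAlgEquiv {M : Set (E →L[ℂ] F)} (hM : Nondegenerate M)
    {C : StarSubalgebra ℂ (F →L[ℂ] F)} {D : StarSubalgebra ℂ (E →L[ℂ] E)}
    (hC : ∀ X ∈ C, ∃ Y ∈ D, Intertwined M X Y) (hD : ∀ Y ∈ D, ∃ X ∈ C, Intertwined M X Y) :
    ∃ ζ : C ≃⋆ₐ[ℂ] D, ∀ X : C, Intertwined M (X : F →L[ℂ] F) (ζ X : E →L[ℂ] E) := by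
  choose! f hfD hf using hC
  choose! g hgC hg using hD
  refine ⟨{
    toFun := fun X => ⟨f X, hfD X X.2⟩
    invFun := fun Y => ⟨g Y, hgC Y Y.2⟩
    left_inv := fun X => Subtype.ext <| (hg _ (hfD X X.2)).left_unique hM (hf X X.2)
    right_inv := fun Y => Subtype.ext <| (hf _ (hgC Y Y.2)).right_unique hM (hg Y Y.2)
    map_mul' := fun A B => Subtype.ext <|
      (hf _ (A * B).2).right_unique hM ((hf A A.2).mul (hf B B.2))
    map_add' := fun A B => Subtype.ext <|
      (hf _ (A + B).2).right_unique hM ((hf A A.2).add (hf B B.2))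
    map_star' := fun A => Subtype.ext <| (hf _ (star A).2).right_unique hM (hf A A.2).star
    map_smul' := fun c A => Subtype.ext <|
      (hf _ (c • A).2).right_unique hM ((hf A A.2).smul c) }, fun X => hf X X.2⟩

section WeakTROEquivalence

variable {H₁ H₂ K₁ K₂ : Type*}
  [NormedAddCommGroup H₁] [InnerProductSpace ℂ H₁] [CompleteSpace H₁]
  [NormedAddCommGroup H₂] [InnerProductSpace ℂ H₂] [CompleteSpace H₂]
  [NormedAddCommGroup K₁] [InnerProductSpace ℂ K₁] [CompleteSpace K₁]
  [NormedAddCommGroup K₂] [InnerProductSpace ℂ K₂] [CompleteSpace K₂]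

/-! ### Weak TRO equivalence in terms of matrix coefficients -/

/-- The consequences of a weak TRO equivalence of essential spaces that are expressed by matrix
coefficients. The notion is invariant under exchanging `U` and `V` and under taking adjoints. -/
structure WeakEquiv (M₁ : Set (H₁ →L[ℂ] K₁)) (M₂ : Set (H₂ →L[ℂ] K₂))
    (U : Set (K₁ →L[ℂ] K₂)) (V : Set (H₁ →L[ℂ] H₂)) : Prop where
  nondeg₁ : Nondegenerate M₁
  nondeg₂ : Nondegenerate M₂
  tro₁ : ∀ l ∈ M₁, ∀ m ∈ M₁, ∀ n ∈ M₁, l ∘L adjoint m ∘L n ∈ M₁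
  tro₂ : ∀ l ∈ M₂, ∀ m ∈ M₂, ∀ n ∈ M₂, l ∘L adjoint m ∘L n ∈ M₂
  mem_left : ∀ m ∈ M₂, ∀ v ∈ V, ∀ n ∈ M₁, m ∘L v ∘L adjoint n ∈ U
  mem_right : ∀ m ∈ M₂, ∀ u ∈ U, ∀ n ∈ M₁, adjoint m ∘L u ∘L n ∈ V
  inner_left : ∀ x y, (∀ m ∈ M₂, ∀ v ∈ V, ∀ n ∈ M₁, inner ℂ y (m (v (adjoint n x))) = 0) →
    ∀ u ∈ U, inner ℂ y (u x) = 0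
  inner_right : ∀ x y, (∀ m ∈ M₂, ∀ u ∈ U, ∀ n ∈ M₁, inner ℂ y (adjoint m (u (n x))) = 0) →
    ∀ v ∈ V, inner ℂ y (v x) = 0

theorem IsTRO.comp_mem {M : Submodule ℂ (H₁ →L[ℂ] K₁)} (hM : IsTRO M) {l m n : H₁ →L[ℂ] K₁}
    (hl : l ∈ M) (hm : m ∈ M) (hn : n ∈ M) : l ∘L adjoint m ∘L n ∈ M :=
  hM ⟨l, hl, _, adjoint_mem_adj hm, n, hn, rfl⟩

/-- Nondegeneracy of the TROs is inherited: if `M₁ x = 0`, all coefficients of `M₂* U M₁` at `x`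
vanish, so `V x = 0` and `x = 0`. The other three cases are analogous. -/
theorem Implements.weakEquiv {M₁ : Submodule ℂ (H₁ →L[ℂ] K₁)} {M₂ : Submodule ℂ (H₂ →L[ℂ] K₂)}
    {U : Submodule ℂ (K₁ →L[ℂ] K₂)} {V : Submodule ℂ (H₁ →L[ℂ] H₂)}
    (h : Implements M₁ M₂ U V) (hU : IsEssential U) (hV : IsEssential V) :
    WeakEquiv (M₁ : Set (H₁ →L[ℂ] K₁)) (M₂ : Set (H₂ →L[ℂ] K₂)) (U : Set (K₁ →L[ℂ] K₂))
      (V : Set (H₁ →L[ℂ] H₂)) := by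
  have hleft : ∀ x y, (∀ m ∈ M₂, ∀ v ∈ V, ∀ n ∈ M₁, inner ℂ y (m (v (adjoint n x))) = 0) →
      ∀ u ∈ U, inner ℂ y (u x) = 0 := by
    intro x y hxy u hu
    rw [← SetLike.mem_coe, h.eq_left] at hu
    refine inner_eq_zero_of_mem_wspan hu ?_
    rintro _ ⟨m, hm, v, hv, _, ⟨n, hn, rfl⟩, rfl⟩
    exact hxy m hm v hv n hn
  have hright : ∀ x y,
      (∀ m ∈ M₂, ∀ u ∈ U, ∀ n ∈ M₁, inner ℂ y (adjoint m (u (n x))) = 0) →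
      ∀ v ∈ V, inner ℂ y (v x) = 0 := by
    intro x y hxy v hv
    rw [← SetLike.mem_coe, h.eq_right] at hv
    refine inner_eq_zero_of_mem_wspan hv ?_
    rintro _ ⟨_, ⟨m, hm, rfl⟩, u, hu, n, hn, rfl⟩
    exact hxy m hm u hu n hn
  have hzero : ∀ (T : K₁ →L[ℂ] K₂) y, (∀ x, inner ℂ y (T x) = 0) → adjoint T y = 0 :=
    fun T y hT => ext_inner_right ℂ fun x => by rw [adjoint_inner_left, hT, inner_zero_left]
  have hzero' : ∀ (T : H₁ →L[ℂ] H₂) y, (∀ x, inner ℂ y (T x) = 0) → adjoint T y = 0 :=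
    fun T y hT => ext_inner_right ℂ fun x => by rw [adjoint_inner_left, hT, inner_zero_left]
  exact
  { nondeg₁ :=
    { right := fun x hx => hV.nondegenerate.right x fun v hv => ext_inner_left ℂ fun y => by
        rw [inner_zero_right]
        exact hright x y (fun m _ u _ n hn => by simp [hx n hn]) v hv
      left := fun x hx => hU.nondegenerate.right x fun u hu => ext_inner_left ℂ fun y => by
        rw [inner_zero_right]
        exact hleft x y (fun m _ v _ n hn => by simp [hx n hn]) u hu }
    nondeg₂ :=
    { right := fun y hy => hV.nondegenerate.left y fun v hv => hzero' _ _ fun x =>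
        hright x y (fun m hm u _ n _ => by
          rw [adjoint_inner_right, hy m hm, inner_zero_left]) v hv
      left := fun y hy => hU.nondegenerate.left y fun u hu => hzero _ _ fun x =>
        hleft x y (fun m hm v _ n _ => by
          rw [← adjoint_inner_left, hy m hm, inner_zero_left]) u hu }
    tro₁ := fun _ hl _ hm _ hn => h.tro₁.comp_mem hl hm hn
    tro₂ := fun _ hl _ hm _ hn => h.tro₂.comp_mem hl hm hn
    mem_left := fun m hm v hv n hn => by
      rw [h.eq_left]
      exact subset_wspan _ ⟨m, hm, v, hv, _, adjoint_mem_adj hn, rfl⟩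
    mem_right := fun m hm u hu n hn => by
      rw [h.eq_right]
      exact subset_wspan _ ⟨_, adjoint_mem_adj hm, u, hu, n, hn, rfl⟩
    inner_left := hleft
    inner_right := hright }

/-- The projections in the range of `Map U`. -/
def mapRange (U : Set (K₁ →L[ℂ] K₂)) : Set (K₂ →L[ℂ] K₂) :=
  {Q | ∃ P : K₁ →L[ℂ] K₁, IsStarProjection P ∧ Q = Map U P}

namespace WeakEquiv

variable {M₁ : Set (H₁ →L[ℂ] K₁)} {M₂ : Set (H₂ →L[ℂ] K₂)}
    {U : Set (K₁ →L[ℂ] K₂)} {V : Set (H₁ →L[ℂ] H₂)}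

theorem symm (h : WeakEquiv M₁ M₂ U V) : WeakEquiv (adj M₁) (adj M₂) V U where
  nondeg₁ := h.nondeg₁.adj
  nondeg₂ := h.nondeg₂.adj
  tro₁ := by
    simp only [forall_mem_adj]
    intro l hl m hm n hn
    exact ⟨_, h.tro₁ n hn m hm l hl, by simp [adjoint_comp, comp_assoc]⟩
  tro₂ := by
    simp only [forall_mem_adj]
    intro l hl m hm n hn
    exact ⟨_, h.tro₂ n hn m hm l hl, by simp [adjoint_comp, comp_assoc]⟩
  mem_left := by
    simp only [forall_mem_adj, adjoint_adjoint]
    exact h.mem_right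
  mem_right := by
    simp only [forall_mem_adj, adjoint_adjoint]
    exact h.mem_left
  inner_left := by
    simp only [forall_mem_adj, adjoint_adjoint]
    exact h.inner_right
  inner_right := by
    simp only [forall_mem_adj, adjoint_adjoint]
    exact h.inner_left

theorem adjoint (h : WeakEquiv M₁ M₂ U V) : WeakEquiv M₂ M₁ (adj U) (adj V) where
  nondeg₁ := h.nondeg₂
  nondeg₂ := h.nondeg₁
  tro₁ := h.tro₂
  tro₂ := h.tro₁
  mem_left := by
    simp only [forall_mem_adj]
    intro m hm v hv n hn
    exact ⟨_, h.mem_left n hn v hv m hm, by simp [adjoint_comp, comp_assoc]⟩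
  mem_right := by
    simp only [forall_mem_adj]
    intro m hm v hv n hn
    exact ⟨_, h.mem_right n hn v hv m hm, by simp [adjoint_comp, comp_assoc]⟩
  inner_left := by
    simp only [forall_mem_adj]
    intro x y hxy u hu
    rw [adjoint_inner_right, inner_eq_zero_symm]
    refine h.inner_left y x (fun m hm v hv n hn => ?_) u hu
    rw [inner_eq_zero_symm, ← hxy n hn v hv m hm]
    simp only [← adjoint_inner_left, adjoint_adjoint]
  inner_right := by
    simp only [forall_mem_adj]
    intro x y hxy u hu
    rw [adjoint_inner_right, inner_eq_zero_symm]
    refine h.inner_right y x (fun m hm v hv n hn => ?_) u hu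
    rw [inner_eq_zero_symm, ← hxy n hn v hv m hm]
    simp only [← adjoint_inner_left, adjoint_adjoint]

/-- `V` absorbs `M₂* M₂`, in terms of matrix coefficients. -/
theorem inner_adjoint_comp_comp (h : WeakEquiv M₁ M₂ U V) {x : H₁} {y : H₂}
    (hxy : ∀ v ∈ V, inner ℂ y (v x) = 0) {m n : H₂ →L[ℂ] K₂} (hm : m ∈ M₂) (hn : n ∈ M₂)
    {v : H₁ →L[ℂ] H₂} (hv : v ∈ V) :
    inner ℂ y (ContinuousLinearMap.adjoint m (n (v x))) = 0 := by
  rw [adjoint_inner_right, ← adjoint_inner_left]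
  refine h.inner_right _ _ (fun l hl u hu k hk => ?_) v hv
  rw [adjoint_inner_left, ← adjoint_inner_right]
  -- By the TRO property `m* n l* = (l n* m)*` lies in `M₂*`, so `m* n l* u k` lies in `V`.
  have := hxy _ (h.mem_right _ (h.tro₂ l hl n hn m hm) u hu k hk)
  simpa [adjoint_comp] using this

/-- `χ₂* ∘ Map U = Map V ∘ χ₁*`. -/
theorem intertwined_map (h : WeakEquiv M₁ M₂ U V) (P : K₁ →L[ℂ] K₁) :
    Intertwined M₂ (Map U P) (Map V (Map (adj M₁) P)) := by
  have hmem : ∀ n ∈ M₁, ∀ x, ContinuousLinearMap.adjoint n (P x) =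
      Map (adj M₁) P (ContinuousLinearMap.adjoint n (P x)) := fun n hn x =>
    (Submodule.starProjection_eq_self_iff.2 <| Submodule.le_topologicalClosure _ <|
      Submodule.subset_span (by exact ⟨_, adjoint_mem_adj hn, x, rfl⟩)).symm
  refine Intertwined.of_submodules (fun m hm z hz => ?_) fun m hm w hw => ?_
  · refine mem_topologicalClosure_of_orthogonal fun y hy => ?_
    rw [← adjoint_inner_left]
    refine inner_eq_zero_of_mem_topologicalClosure hz ?_
    rintro _ ⟨v, hv, x, rfl⟩
    rw [adjoint_inner_left, ← adjoint_inner_left, ← adjoint_inner_left]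
    refine inner_eq_zero_of_mem_topologicalClosure (Submodule.starProjection_apply_mem _ x) ?_
    rintro _ ⟨_, ⟨n, hn, rfl⟩, k, rfl⟩
    rw [adjoint_inner_left, adjoint_inner_left]
    exact hy _ ⟨_, h.mem_left m hm v hv n hn, k, rfl⟩
  -- Coefficients of `u` are controlled by those of `l v n*`, and `m* l` is absorbed into `V`.
  · refine mem_topologicalClosure_of_orthogonal fun y hy => ?_
    rw [adjoint_inner_right]
    refine inner_eq_zero_of_mem_topologicalClosure hw ?_
    rintro _ ⟨u, hu, x, rfl⟩
    refine h.inner_left _ _ (fun l hl v hv n hn => ?_) u hu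
    rw [← adjoint_inner_right]
    refine h.inner_adjoint_comp_comp (fun v hv => ?_) hm hl hv
    exact hy _ ⟨v, hv, ContinuousLinearMap.adjoint n (P x), by rw [← hmem n hn x]⟩

theorem exists_mapRange (h : WeakEquiv M₁ M₂ U V) :
    ∀ Q ∈ mapRange U, ∃ Q' ∈ mapRange V, Intertwined M₂ Q Q' := by
  rintro _ ⟨P, -, rfl⟩
  exact ⟨_, ⟨_, isStarProjection_starProjection, rfl⟩, h.intertwined_map P⟩

theorem exists_mapRange_symm (h : WeakEquiv M₁ M₂ U V) :
    ∀ Q' ∈ mapRange V, ∃ Q ∈ mapRange U, Intertwined M₂ Q Q' := by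
  intro Q' hQ'
  obtain ⟨Q, hQ, hi⟩ := h.symm.exists_mapRange Q' hQ'
  exact ⟨Q, hQ, by simpa using hi.symm⟩

/-- If `ζ₁` and `ζ₂` stand for the correspondences given by `M₁` and `M₂` and `(1 - P) U Q = 0`,
then `(1 - ζ₂ P) V (ζ₁ Q) = 0`. -/
theorem inner_apply_eq_zero (h : WeakEquiv M₁ M₂ U V) {P : K₂ →L[ℂ] K₂} {P' : H₂ →L[ℂ] H₂}
    {Q : K₁ →L[ℂ] K₁} {Q' : H₁ →L[ℂ] H₁} (hP : Intertwined M₂ P P') (hQ : Intertwined M₁ Q Q')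
    (hPQ : ∀ u ∈ U, ∀ x y, inner ℂ (P y) (u (Q x)) = 0) {v : H₁ →L[ℂ] H₂} (hv : v ∈ V)
    (x : H₁) (y : H₂) : inner ℂ (P' y) (v (Q' x)) = 0 := by
  refine h.inner_right _ _ (fun m hm u hu n hn => ?_) v hv
  rw [adjoint_inner_right, (hP m hm).1, (hQ n hn).1]
  exact hPQ u hu _ _

end WeakEquiv

/-- A reflexive space `U` contains the products of the elements of `V` with operators that
intertwine the projections of `S2 U` and `S1 U` with their counterparts for `V`. -/
theorem IsReflexive.comp_mem {M₁ : Set (H₁ →L[ℂ] K₁)} {M₂ : Set (H₂ →L[ℂ] K₂)}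
    {U : Submodule ℂ (K₁ →L[ℂ] K₂)} {V : Set (H₁ →L[ℂ] H₂)} (hU : IsReflexive U)
    (h : WeakEquiv M₁ M₂ (U : Set (K₁ →L[ℂ] K₂)) V) {R : H₂ →L[ℂ] K₂} {S : K₁ →L[ℂ] H₁}
    (hR : ∀ P ∈ S2 U, ∃ P', Intertwined M₂ P P' ∧ R ∘L P' = P ∘L R)
    (hS : ∀ Q ∈ S1 U, ∃ Q', Intertwined M₁ Q Q' ∧ Q' ∘L S = S ∘L Q)
    {v : H₁ →L[ℂ] H₂} (hv : v ∈ V) : R ∘L v ∘L S ∈ U := by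
  refine hU.mem_of_inner fun x y hxy => ?_
  -- `P` projects onto the closure of `U x`, and `Q` onto the vectors that `U` maps into the range
  -- of `P`, among them `x`.
  set p : K₁ →L[ℂ] K₁ := (ℂ ∙ x).starProjection with hp
  set P : K₂ →L[ℂ] K₂ := Map (U : Set (K₁ →L[ℂ] K₂)) p with hPdef
  have hPproj : IsStarProjection P := isStarProjection_starProjection
  set Q : K₁ →L[ℂ] K₁ := 1 - Map (adj (U : Set (K₁ →L[ℂ] K₂))) (1 - P) with hQdef
  have hP1 : IsStarProjection (1 - P) := hPproj.one_sub
  obtain ⟨P', hPP', hRP⟩ := hR P ⟨p, isStarProjection_starProjection, rfl⟩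
  obtain ⟨Q', hQQ', hSQ⟩ := hS Q ⟨1 - P, hP1, rfl⟩
  have hPux : ∀ u ∈ U, P (u x) = u x := fun u hu =>
    Submodule.starProjection_eq_self_iff.2 <| Submodule.le_topologicalClosure _ <|
      Submodule.subset_span ⟨u, hu, x, by
        rw [hp, Submodule.starProjection_eq_self_iff.2 (Submodule.mem_span_singleton_self x)]⟩
  have hPy : P y = 0 := by
    refine Submodule.eq_starProjection_of_mem_of_inner_eq_zero (zero_mem _) fun w hw => ?_
    rw [sub_zero]
    refine inner_eq_zero_of_mem_topologicalClosure hw ?_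
    rintro _ ⟨u, hu, k, rfl⟩
    obtain ⟨c, hc⟩ := Submodule.mem_span_singleton.1
      (Submodule.starProjection_apply_mem (ℂ ∙ x) k)
    rw [hp, ← hc, map_smul, inner_smul_right, hxy u hu, mul_zero]
  have hsub : ∀ u ∈ U, ∀ a b, inner ℂ ((1 - P) a) (u (Q b)) = 0 := by
    intro u hu a b
    rw [← adjoint_inner_left]
    refine (Submodule.mem_orthogonal _ _).1
      (Submodule.sub_starProjection_mem_orthogonal (K := (Submodule.span ℂ
        {z | ∃ T ∈ adj (U : Set (K₁ →L[ℂ] K₂)), ∃ y, z = T ((1 - P) y)}).topologicalClosure) b)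
      _ (Submodule.le_topologicalClosure _ (Submodule.subset_span
        ⟨_, adjoint_mem_adj hu, a, rfl⟩))
  have hQx : Q x = x := by
    have hzero : Map (adj (U : Set (K₁ →L[ℂ] K₂))) (1 - P) x = 0 := by
      refine Submodule.eq_starProjection_of_mem_of_inner_eq_zero (zero_mem _) fun w hw => ?_
      rw [sub_zero]
      refine inner_eq_zero_of_mem_topologicalClosure hw ?_
      rintro _ ⟨_, ⟨u, hu, rfl⟩, k, rfl⟩
      have hadj : adjoint (1 - P) = 1 - P := hP1.isSelfAdjoint
      rw [adjoint_inner_right, ← adjoint_inner_left, hadj, sub_apply, hPux u hu]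
      simp
    simp [hQdef, hzero]
  -- The relation `(1 - P) U Q = 0` becomes `(1 - P') V Q' = 0`, tested at `S x` and `R* y`. These
  -- are fixed by `Q'` and `1 - P'`, since `Q' S x = S Q x` and `P' R* y = R* P y = 0`.
  have hv0 := h.inner_apply_eq_zero (Intertwined.one.sub hPP') hQQ'
    (fun u hu a b => hsub u hu b a) hv (S x) (adjoint R y)
  have hPR : adjoint P' (adjoint R y) = 0 := by
    have h1 : adjoint (R ∘L P') y = adjoint (P ∘L R) y := by rw [hRP]
    have h2 : adjoint P = P := hPproj.isSelfAdjoint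
    simpa [adjoint_comp, h2, hPy] using h1
  have hP'sa : adjoint P' = P' := by
    have h2 : star P = P := hPproj.isSelfAdjoint
    have h3 := hPP'.star
    rw [h2] at h3
    exact h3.right_unique h.nondeg₂ hPP'
  have hSx : Q' (S x) = S x := by
    have h1 : Q' (S x) = S (Q x) := congr($hSQ x)
    rw [h1, hQx]
  rw [hP'sa] at hPR
  rw [hSx, sub_apply, hPR, sub_zero, one_apply_eq_self, adjoint_inner_left] at hv0
  exact hv0

/-! ### Spaces of intertwiners -/

section Intertwiners

variable {C : StarSubalgebra ℂ (K₁ →L[ℂ] K₁)} {D : StarSubalgebra ℂ (H₁ →L[ℂ] H₁)}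
  (ζ : C ≃⋆ₐ[ℂ] D)

theorem adjoint_coe_apply {P : C} (hP : IsStarProjection (P : K₁ →L[ℂ] K₁)) :
    adjoint (ζ P : H₁ →L[ℂ] H₁) = ζ P := by
  have h1 : star P = P := Subtype.ext hP.isSelfAdjoint
  have h2 : star (ζ P) = ζ P := by rw [← map_star, h1]
  exact congr(($h2 : H₁ →L[ℂ] H₁))

theorem adjoint_comp_of_mem_intertwiners {T : H₁ →L[ℂ] K₁} (hT : T ∈ intertwiners ζ) {P : C}
    (hP : IsStarProjection (P : K₁ →L[ℂ] K₁)) :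
    (ζ P : H₁ →L[ℂ] H₁) ∘L adjoint T = adjoint T ∘L (P : K₁ →L[ℂ] K₁) := by
  have h1 := congr(adjoint $(hT P hP))
  have h2 : adjoint (P : K₁ →L[ℂ] K₁) = P := hP.isSelfAdjoint
  rwa [adjoint_comp, adjoint_comp, adjoint_coe_apply ζ hP, h2] at h1

theorem isTRO_intertwiners : IsTRO (intertwiners ζ) := by
  rintro _ ⟨R, hR, _, ⟨S, hS, rfl⟩, T, hT, rfl⟩ P hP
  rw [comp_assoc, comp_assoc, hT P hP, ← comp_assoc (adjoint S),
    ← adjoint_comp_of_mem_intertwiners ζ hS hP, comp_assoc, ← comp_assoc R, hR P hP, comp_assoc]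

theorem subset_intertwiners {M : Set (H₁ →L[ℂ] K₁)}
    (h : ∀ X : C, Intertwined M (X : K₁ →L[ℂ] K₁) (ζ X : H₁ →L[ℂ] H₁)) :
    M ⊆ intertwiners ζ := fun m hm P _ => by
  ext1 x
  exact (h P m hm).1 x

end Intertwiners

/-! ### Isomorphisms of double commutants and the conclusion -/

theorem adj_mono {S T : Set (H₁ →L[ℂ] K₁)} (h : S ⊆ T) : adj S ⊆ adj T := Set.image_mono h

theorem triple_mono {X X' : Set (H₂ →L[ℂ] K₂)} {Y : Set (H₁ →L[ℂ] H₂)}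
    {Z Z' : Set (K₁ →L[ℂ] H₁)} (hX : X ⊆ X') (hZ : Z ⊆ Z') :
    triple X Y Z ⊆ triple X' Y Z' := by
  rintro _ ⟨x, hx, y, hy, z, hz, rfl⟩
  exact ⟨x, hX hx, y, hy, z, hZ hz, rfl⟩

theorem subset_comm_comm (S : Set (K₁ →L[ℂ] K₁)) : S ⊆ comm (comm S : Set (K₁ →L[ℂ] K₁)) := by
  intro s hs
  refine (StarSubalgebra.mem_centralizer_iff ℂ).2 fun g hg => ?_
  exact ⟨((StarSubalgebra.mem_centralizer_iff ℂ).1 hg s hs).1.symm,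
    ((StarSubalgebra.mem_centralizer_iff ℂ).1 (star_mem hg) s hs).1.symm⟩

theorem exists_starAlgEquiv_comm_comm {M : Set (H₁ →L[ℂ] K₁)} (hM : Nondegenerate M)
    {S : Set (K₁ →L[ℂ] K₁)} {S' : Set (H₁ →L[ℂ] H₁)}
    (hS : ∀ s ∈ S, ∃ t ∈ S', Intertwined M s t) (hS' : ∀ t ∈ S', ∃ s ∈ S, Intertwined M s t) :
    ∃ ζ : comm (comm S : Set (K₁ →L[ℂ] K₁)) ≃⋆ₐ[ℂ] comm (comm S' : Set (H₁ →L[ℂ] H₁)),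
      ∀ X : comm (comm S : Set (K₁ →L[ℂ] K₁)),
        Intertwined M (X : K₁ →L[ℂ] K₁) (ζ X : H₁ →L[ℂ] H₁) := by
  refine exists_starAlgEquiv hM (fun X hX => exists_intertwined_comm_comm hM hS hX)
    fun Y hY => ?_
  have hS'' : ∀ t ∈ S', ∃ s ∈ S, Intertwined (adj M) t s := fun t ht => by
    obtain ⟨s, hs, hst⟩ := hS' t ht
    exact ⟨s, hs, hst.symm⟩
  obtain ⟨X, hX, hYX⟩ := exists_intertwined_comm_comm hM.adj hS'' hY
  exact ⟨X, hX, by simpa using hYX.symm⟩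

theorem isStarProjection_of_mem_S2 {U : Submodule ℂ (K₁ →L[ℂ] K₂)} {P : K₂ →L[ℂ] K₂}
    (hP : P ∈ S2 U) : IsStarProjection P := by
  obtain ⟨p, -, rfl⟩ := hP
  exact isStarProjection_starProjection

theorem isStarProjection_of_mem_S1 {U : Submodule ℂ (K₁ →L[ℂ] K₂)} {P : K₁ →L[ℂ] K₁}
    (hP : P ∈ S1 U) : IsStarProjection P := by
  obtain ⟨p, -, rfl⟩ := hP
  exact isStarProjection_starProjection.one_sub

namespace WeakEquiv

variable {M₁ : Set (H₁ →L[ℂ] K₁)} {M₂ : Set (H₂ →L[ℂ] K₂)}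
    {U : Submodule ℂ (K₁ →L[ℂ] K₂)} {V : Submodule ℂ (H₁ →L[ℂ] H₂)}

/-- Passing to adjoint spaces exchanges the indices 1 and 2 and replaces `φ` by `φ*`, so this
reduces to the case of `M₂`. -/
theorem exists_S1 (h : WeakEquiv M₁ M₂ (U : Set (K₁ →L[ℂ] K₂)) (V : Set (H₁ →L[ℂ] H₂))) :
    ∀ Q ∈ S1 U, ∃ Q' ∈ S1 V, Intertwined M₁ Q Q' := by
  rintro _ ⟨P, hP, rfl⟩
  obtain ⟨_, ⟨P', hP', rfl⟩, hi⟩ := h.adjoint.exists_mapRange _ ⟨P, hP, rfl⟩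
  exact ⟨_, ⟨P', hP', rfl⟩, Intertwined.one.sub hi⟩

theorem exists_S1_symm (h : WeakEquiv M₁ M₂ (U : Set (K₁ →L[ℂ] K₂)) (V : Set (H₁ →L[ℂ] H₂))) :
    ∀ Q' ∈ S1 V, ∃ Q ∈ S1 U, Intertwined M₁ Q Q' := by
  intro Q' hQ'
  obtain ⟨Q, hQ, hi⟩ := h.symm.exists_S1 Q' hQ'
  exact ⟨Q, hQ, by simpa using hi.symm⟩

end WeakEquiv

/-- The spaces of intertwiners of the *-isomorphisms induced by the TROs of a weak TRO equivalence
of essential reflexive spaces implement the equivalence. -/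
theorem Implements.exists_starAlgEquiv {M₁ : Submodule ℂ (H₁ →L[ℂ] K₁)}
    {M₂ : Submodule ℂ (H₂ →L[ℂ] K₂)} {U : Submodule ℂ (K₁ →L[ℂ] K₂)}
    {V : Submodule ℂ (H₁ →L[ℂ] H₂)} (hM : Implements M₁ M₂ U V) (hUess : IsEssential U)
    (hVess : IsEssential V) (hUref : IsReflexive U) (hVref : IsReflexive V) :
    ∃ (ζ₁ : comm (alg1 U : Set (K₁ →L[ℂ] K₁)) ≃⋆ₐ[ℂ] comm (alg1 V : Set (H₁ →L[ℂ] H₁)))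
      (ζ₂ : comm (alg2 U : Set (K₂ →L[ℂ] K₂)) ≃⋆ₐ[ℂ] comm (alg2 V : Set (H₂ →L[ℂ] H₂))),
      Extends ζ₁ M₁ ∧ Extends ζ₂ M₂ ∧ Implements (intertwiners ζ₁) (intertwiners ζ₂) U V := by
  have h := hM.weakEquiv hUess hVess
  obtain ⟨ζ₁, hζ₁⟩ : ∃ ζ₁ : comm (alg1 U : Set (K₁ →L[ℂ] K₁)) ≃⋆ₐ[ℂ]
      comm (alg1 V : Set (H₁ →L[ℂ] H₁)), ∀ X : comm (alg1 U : Set (K₁ →L[ℂ] K₁)),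
      Intertwined (M₁ : Set (H₁ →L[ℂ] K₁)) (X : K₁ →L[ℂ] K₁) (ζ₁ X : H₁ →L[ℂ] H₁) :=
    exists_starAlgEquiv_comm_comm h.nondeg₁ h.exists_S1 h.exists_S1_symm
  obtain ⟨ζ₂, hζ₂⟩ : ∃ ζ₂ : comm (alg2 U : Set (K₂ →L[ℂ] K₂)) ≃⋆ₐ[ℂ]
      comm (alg2 V : Set (H₂ →L[ℂ] H₂)), ∀ X : comm (alg2 U : Set (K₂ →L[ℂ] K₂)),
      Intertwined (M₂ : Set (H₂ →L[ℂ] K₂)) (X : K₂ →L[ℂ] K₂) (ζ₂ X : H₂ →L[ℂ] H₂) :=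
    exists_starAlgEquiv_comm_comm h.nondeg₂ h.exists_mapRange h.exists_mapRange_symm
  have hsub₁ := subset_intertwiners ζ₁ hζ₁
  have hsub₂ := subset_intertwiners ζ₂ hζ₂
  refine ⟨ζ₁, ζ₂, fun P hP => (hζ₁ P).eq_map h.nondeg₁ hP,
    fun P hP => (hζ₂ P).eq_map h.nondeg₂ hP,
    isTRO_intertwiners ζ₁, isTRO_intertwiners ζ₂, Set.Subset.antisymm ?_ ?_,
    Set.Subset.antisymm ?_ ?_⟩
  · conv_lhs => rw [hM.eq_left]
    exact wspan_mono (triple_mono hsub₂ (adj_mono hsub₁))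
  · refine hUref.wspan_subset ?_
    rintro _ ⟨R, hR, v, hv, _, ⟨S, hS, rfl⟩, rfl⟩
    refine hUref.comp_mem h (fun P hP => ?_) (fun Q hQ => ?_) hv
    · let X : comm (alg2 U : Set (K₂ →L[ℂ] K₂)) := ⟨P, subset_comm_comm _ hP⟩
      exact ⟨_, hζ₂ X, hR X (isStarProjection_of_mem_S2 hP)⟩
    · let X : comm (alg1 U : Set (K₁ →L[ℂ] K₁)) := ⟨Q, subset_comm_comm _ hQ⟩
      exact ⟨_, hζ₁ X, adjoint_comp_of_mem_intertwiners ζ₁ hS (isStarProjection_of_mem_S1 hQ)⟩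
  · conv_lhs => rw [hM.eq_right]
    exact wspan_mono (triple_mono (adj_mono hsub₂) hsub₁)
  · refine hVref.wspan_subset ?_
    rintro _ ⟨_, ⟨R, hR, rfl⟩, u, hu, S, hS, rfl⟩
    refine hVref.comp_mem h.symm (fun P hP => ?_) (fun Q hQ => ?_) hu
    -- `ζ₂` starts from the `U` side, so `P` is first pulled back to `S2 U`; uniqueness identifies
    -- the image with `P`.
    · obtain ⟨P', hP', hi⟩ := h.exists_mapRange_symm P hP
      let X : comm (alg2 U : Set (K₂ →L[ℂ] K₂)) := ⟨P', subset_comm_comm _ hP'⟩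
      have hX : (ζ₂ X : H₂ →L[ℂ] H₂) = P := (hζ₂ X).right_unique h.nondeg₂ hi
      refine ⟨P', hi.symm, ?_⟩
      rw [← hX]
      exact (adjoint_comp_of_mem_intertwiners ζ₂ hR (P := X)
        (isStarProjection_of_mem_S2 hP')).symm
    · obtain ⟨Q', hQ', hi⟩ := h.exists_S1_symm Q hQ
      let X : comm (alg1 U : Set (K₁ →L[ℂ] K₁)) := ⟨Q', subset_comm_comm _ hQ'⟩
      have hX : (ζ₁ X : H₁ →L[ℂ] H₁) = Q := (hζ₁ X).right_unique h.nondeg₁ hi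
      refine ⟨Q', hi.symm, ?_⟩
      rw [← hX]
      exact (hS X (isStarProjection_of_mem_S1 hQ')).symm

end WeakTROEquivalence

end WeakTRO

end

theorem theorem2p3 {H₁ H₂ K₁ K₂ : Type*}
    [NormedAddCommGroup H₁] [InnerProductSpace ℂ H₁] [CompleteSpace H₁]
    [NormedAddCommGroup H₂] [InnerProductSpace ℂ H₂] [CompleteSpace H₂]
    [NormedAddCommGroup K₁] [InnerProductSpace ℂ K₁] [CompleteSpace K₁]
    [NormedAddCommGroup K₂] [InnerProductSpace ℂ K₂] [CompleteSpace K₂]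
    (U : Submodule ℂ (K₁ →L[ℂ] K₂)) (V : Submodule ℂ (H₁ →L[ℂ] H₂))
    (hUess : WeakTRO.IsEssential U) (hVess : WeakTRO.IsEssential V)
    (hUref : WeakTRO.IsReflexive U) (hVref : WeakTRO.IsReflexive V)
    (M₁ : Submodule ℂ (H₁ →L[ℂ] K₁)) (M₂ : Submodule ℂ (H₂ →L[ℂ] K₂))
    (hM : WeakTRO.Implements M₁ M₂ U V) :
    ∃ (ζ₁ : WeakTRO.comm (WeakTRO.alg1 U : Set (K₁ →L[ℂ] K₁)) ≃⋆ₐ[ℂ]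
          WeakTRO.comm (WeakTRO.alg1 V : Set (H₁ →L[ℂ] H₁)))
      (ζ₂ : WeakTRO.comm (WeakTRO.alg2 U : Set (K₂ →L[ℂ] K₂)) ≃⋆ₐ[ℂ]
          WeakTRO.comm (WeakTRO.alg2 V : Set (H₂ →L[ℂ] H₂))),
      WeakTRO.Extends ζ₁ M₁ ∧ WeakTRO.Extends ζ₂ M₂ ∧
      WeakTRO.Implements (WeakTRO.intertwiners ζ₁) (WeakTRO.intertwiners ζ₂) U V :=
  hM.exists_starAlgEquiv hUess hVess hUref hVref
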